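/- Let $n,m,p$ be non-negative integers, $A\in\mathbb R^{n\times n}$, $B\in\mathbb R^{n\times m}$ with $(A,B)$ controllable, and for $\lambda\in\mathbb R^p$ let $$Q(\lambda)=Q_0+\sum_{i=1}^p\lambda_iQ_i,\qquad S(\lambda)=S_0+\sum_{i=1}^p\lambda_iS_i,\qquad R(\lambda)=R_0+\sum_{i=1}^p\lambda_iR_i,$$ where $Q_i\in\mathbb R^{n\times n}$ and $R_i\in\mathbb R^{m\times m}$ are symmetric and $S_i\in\mathbb R^{n\times m}$ $(i=0,\dots,p)$. Write $\mathbb S^n$ for the set of real symmetric $n\times n$ matrices, and for symmetric matrices let $X\prec Y$ (resp. $X\preceq Y$) mean that $Y-X$ is positive definite (resp. positive semidefinite). Where $R(\lambda)$ is invertible, put, for $P\in\mathbb S^n$, $$F(P,\lambda)=A^\top P+PA+Q(\lambda)-(PB+S(\lambda))R(\lambda)^{-1}(PB+S(\lambda))^\top,\qquad K_P=R(\lambda)^{-1}(PB+S(\lambda))^\top .$$ A matrix $P\in\mathbb S^n$ with $F(P,\lambda)=0$ is called a stabilizing (resp. anti-stabilizing) solution if all complex eigenvalues of $A-BK_P$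 have negative (resp. positive) real part. Fix $\lambda\in\mathbb R^p$ with $R(\lambda)\prec0$. Then there is a $P\in\mathbb S^n$ with $F(P,\lambda)\prec0$ if and only if there exist both an anti-stabilizing solution $P_+$ and a stabilizing solution $P_-$ of $F(P,\lambda)=0$. If this is the case, then for all such $P_+$ and $P_-$ the following hold. 1. Every $P\in\mathbb S^n$ with $F(P,\lambda)\preceq0$ satisfies $P_-\preceq P\preceq P_+$. 2. For every $\varepsilon>0$ there is a $P\in\mathbb S^n$ with $F(P,\lambda)\prec0$ and $P_+-\varepsilon I\prec P\prec P_+$. 3. $\Delta:=P_+-P_-\succ0$. -/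

import Mathlib

/-- Matrix data of the parametrized Riccati equation: the system matrices `A`, `B` and the
coefficients of the affine matrix-valued functions `Q(x) = Q₀ + ∑ xᵢ Qᵢ`, `S(x) = S₀ + ∑ xᵢ Sᵢ`,
`R(x) = R₀ + ∑ xᵢ Rᵢ`, where all coefficients of `Q` and `R` are symmetric. -/
structure KYPData (n m p : ℕ) where
  A : Matrix (Fin n) (Fin n) ℝ
  B : Matrix (Fin n) (Fin m) ℝ
  Q₀ : Matrix (Fin n) (Fin n) ℝ
  Qc : Fin p → Matrix (Fin n) (Fin n) ℝ
  S₀ : Matrix (Fin n) (Fin m) ℝ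
  Sc : Fin p → Matrix (Fin n) (Fin m) ℝ
  R₀ : Matrix (Fin m) (Fin m) ℝ
  Rc : Fin p → Matrix (Fin m) (Fin m) ℝ
  Q₀_symm : Q₀.IsSymm
  Qc_symm : ∀ i, (Qc i).IsSymm
  R₀_symm : R₀.IsSymm
  Rc_symm : ∀ i, (Rc i).IsSymm

/-- The Kalman controllability matrix `[B, A B, …, A ^ (n - 1) B]`. -/
def controllabilityMatrix {n m : ℕ} (A : Matrix (Fin n) (Fin n) ℝ)
    (B : Matrix (Fin n) (Fin m) ℝ) : Matrix (Fin n) (Fin n × Fin m) ℝ :=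
  Matrix.of fun i kj => (A ^ (kj.1 : ℕ) * B) i kj.2

/-- Controllability of the pair `(A, B)` (Kalman rank condition). -/
def IsControllable {n m : ℕ} (A : Matrix (Fin n) (Fin n) ℝ)
    (B : Matrix (Fin n) (Fin m) ℝ) : Prop :=
  (controllabilityMatrix A B).rank = n

/-- All complex eigenvalues of the real matrix `M` have negative real part. -/
def IsStableMatrix {n : ℕ} (M : Matrix (Fin n) (Fin n) ℝ) : Prop :=
  ∀ z ∈ spectrum ℂ (M.map Complex.ofReal), z.re < 0

/-- All complex eigenvalues of the real matrix `M` have positive real part. -/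
def IsAntiStableMatrix {n : ℕ} (M : Matrix (Fin n) (Fin n) ℝ) : Prop :=
  ∀ z ∈ spectrum ℂ (M.map Complex.ofReal), 0 < z.re

namespace KYPData

variable {n m p : ℕ}

/-- `Q(x)`. -/
def Q (D : KYPData n m p) (x : Fin p → ℝ) : Matrix (Fin n) (Fin n) ℝ :=
  D.Q₀ + ∑ i, x i • D.Qc i

/-- `S(x)`. -/
def S (D : KYPData n m p) (x : Fin p → ℝ) : Matrix (Fin n) (Fin m) ℝ :=
  D.S₀ + ∑ i, x i • D.Sc i

/-- `R(x)`. -/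
def R (D : KYPData n m p) (x : Fin p → ℝ) : Matrix (Fin m) (Fin m) ℝ :=
  D.R₀ + ∑ i, x i • D.Rc i

/-- The Riccati map `F(P, x) = Aᵀ P + P A + Q - (P B + S) R⁻¹ (P B + S)ᵀ`. -/
noncomputable def F (D : KYPData n m p) (P : Matrix (Fin n) (Fin n) ℝ) (x : Fin p → ℝ) :
    Matrix (Fin n) (Fin n) ℝ :=
  D.A.transpose * P + P * D.A + D.Q x
    - (P * D.B + D.S x) * (D.R x)⁻¹ * (P * D.B + D.S x).transpose

/-- The gain `K = R⁻¹ (P B + S)ᵀ`. -/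
noncomputable def gain (D : KYPData n m p) (P : Matrix (Fin n) (Fin n) ℝ) (x : Fin p → ℝ) :
    Matrix (Fin m) (Fin n) ℝ :=
  (D.R x)⁻¹ * (P * D.B + D.S x).transpose

/-- `P` is a stabilizing solution `P₋` of the Riccati equation: `P` is symmetric,
`F(P, x) = 0`, and `A - B K` is stable. -/
def IsStabilizingSolution (D : KYPData n m p) (x : Fin p → ℝ)
    (P : Matrix (Fin n) (Fin n) ℝ) : Prop :=
  P.IsSymm ∧ D.F P x = 0 ∧ IsStableMatrix (D.A - D.B * D.gain P x)

/-- `P` is an anti-stabilizing solution `P₊` of the Riccati equation: `P` is symmetric,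
`F(P, x) = 0`, and `A - B K` is anti-stable. -/
def IsAntiStabilizingSolution (D : KYPData n m p) (x : Fin p → ℝ)
    (P : Matrix (Fin n) (Fin n) ℝ) : Prop :=
  P.IsSymm ∧ D.F P x = 0 ∧ IsAntiStableMatrix (D.A - D.B * D.gain P x)

end KYPData

open Matrix Filter Topology

/-! For symmetric `X` the Riccati map expands exactly as F(P + X) = F(P) + MᵀX + XM + XGX, where M =
A - BK_P and G = B(-R)⁻¹Bᵀ ⪰ 0 (`F_add`). All else is Lyapunov theory for this identity.

Existence: if F(P) ≺ 0, then F(P - Y) = 0 is a standard Riccati equation in Y with positive definite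
weight -F(P). The pair (M, G) inherits controllability, so a stabilizing Y exists and P - Y is
stabilizing for F. Replacing M by -M gives the anti-stabilizing P + Y. The standard equation
(`IsControllablePair.exists_riccati_eq_zero`) is solved by minimizing the trace over a compact set
of supersolutions: a Newton step cannot increase the minimizer, hence fixes it, and a fixed point is
a solution.

Comparison: P - P₋ and P₊ - P satisfy Lyapunov equations for the stable matrices M₋ and -M₊, with
right-hand sides that are semidefinite once F(P) ⪯ 0. Strict solutions near P₊ are P₊ - tH, with H ≻
0 from a Lyapunov equation and t small. -/

/-! ### Eigenvectors and decay of powers. -/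

lemma exists_eigenvector_of_mem_spectrum {n : ℕ} {M : Matrix (Fin n) (Fin n) ℂ} {z : ℂ}
    (hz : z ∈ spectrum ℂ M) : ∃ v ≠ 0, M *ᵥ v = z • v := by
  rw [spectrum.mem_iff, Matrix.isUnit_iff_isUnit_det, isUnit_iff_ne_zero, not_not,
    ← Matrix.exists_mulVec_eq_zero_iff] at hz
  obtain ⟨v, hv, h⟩ := hz
  refine ⟨v, hv, ?_⟩
  rw [Matrix.sub_mulVec, sub_eq_zero, Algebra.algebraMap_eq_smul_one, Matrix.smul_mulVec,
    Matrix.one_mulVec] at h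
  exact h.symm

lemma mem_spectrum_of_eigenvector {n : ℕ} {M : Matrix (Fin n) (Fin n) ℂ} {z : ℂ}
    {v : Fin n → ℂ} (hv : v ≠ 0) (h : M *ᵥ v = z • v) : z ∈ spectrum ℂ M := by
  rw [spectrum.mem_iff, Matrix.isUnit_iff_isUnit_det, isUnit_iff_ne_zero, not_not,
    ← Matrix.exists_mulVec_eq_zero_iff]
  refine ⟨v, hv, ?_⟩
  rw [Matrix.sub_mulVec, sub_eq_zero, Algebra.algebraMap_eq_smul_one, Matrix.smul_mulVec,
    Matrix.one_mulVec, h]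

open scoped Matrix.Norms.Operator in
/-- A matrix whose complex eigenvalues lie in the open unit disc has powers tending to zero. -/
lemma tendsto_pow_zero_of_spectrum_lt_one {n : ℕ} (C : Matrix (Fin n) (Fin n) ℂ)
    (h : ∀ z ∈ spectrum ℂ C, ‖z‖ < 1) : Tendsto (fun k : ℕ => C ^ k) atTop (𝓝 0) := by
  rcases Nat.eq_zero_or_pos n with rfl | hn
  · exact tendsto_const_nhds.congr fun k => Subsingleton.elim _ _
  have : Nonempty (Fin n) := ⟨⟨0, hn⟩⟩
  have hr : spectralRadius ℂ C < (1 : NNReal) :=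
    spectrum.spectralRadius_lt_of_forall_lt C fun z hz => by exact_mod_cast h z hz
  obtain ⟨r, hr1, hr2⟩ := ENNReal.lt_iff_exists_nnreal_btwn.1 hr
  -- Gelfand's formula: eventually ‖C^k‖^(1/k) < r, so the norms are dominated by r^k with r < 1.
  have hev := (spectrum.pow_nnnorm_pow_one_div_tendsto_nhds_spectralRadius C).eventually
    (gt_mem_nhds hr1)
  refine tendsto_zero_iff_norm_tendsto_zero.2 ?_
  have hrt : Tendsto (fun k : ℕ => (r : ℝ) ^ k) atTop (𝓝 0) :=
    tendsto_pow_atTop_nhds_zero_of_lt_one r.2 (by exact_mod_cast hr2)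
  refine squeeze_zero' (Eventually.of_forall fun k => norm_nonneg _) ?_ hrt
  filter_upwards [hev, eventually_gt_atTop 0] with k hk hk0
  have hk0' : (k : ℝ) ≠ 0 := by exact_mod_cast hk0.ne'
  have h2 := ENNReal.rpow_le_rpow hk.le (Nat.cast_nonneg (α := ℝ) k)
  rw [← ENNReal.rpow_mul, one_div_mul_cancel hk0', ENNReal.rpow_one, ENNReal.rpow_natCast] at h2
  exact_mod_cast h2

/-! ### Lyapunov theory through the Cayley transform. -/

lemma posSemidef_iff_real {n : ℕ} {M : Matrix (Fin n) (Fin n) ℝ} :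
    M.PosSemidef ↔ M.IsSymm ∧ ∀ x, 0 ≤ x ⬝ᵥ (M *ᵥ x) := by
  rw [Matrix.posSemidef_iff_dotProduct_mulVec]
  simp [Matrix.IsHermitian, Matrix.IsSymm]

lemma posDef_iff_real {n : ℕ} {M : Matrix (Fin n) (Fin n) ℝ} :
    M.PosDef ↔ M.IsSymm ∧ ∀ x, x ≠ 0 → 0 < x ⬝ᵥ (M *ᵥ x) := by
  rw [Matrix.posDef_iff_dotProduct_mulVec]
  simp [Matrix.IsHermitian, Matrix.IsSymm]

/-- The Lyapunov operator `X ↦ Mᵀ X + X M`. -/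
def lyapunov {n : ℕ} (M X : Matrix (Fin n) (Fin n) ℝ) : Matrix (Fin n) (Fin n) ℝ :=
  Mᵀ * X + X * M

lemma Matrix.IsSymm.lyapunov {n : ℕ} {M X : Matrix (Fin n) (Fin n) ℝ} (hX : X.IsSymm) :
    (lyapunov M X).IsSymm := by
  unfold _root_.lyapunov Matrix.IsSymm
  rw [Matrix.transpose_add, Matrix.transpose_mul, Matrix.transpose_mul, Matrix.transpose_transpose,
    hX.eq, add_comm]

lemma dotProduct_transpose_mul_mulVec {n m : ℕ} (N : Matrix (Fin m) (Fin n) ℝ)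
    (X : Matrix (Fin m) (Fin m) ℝ) (x : Fin n → ℝ) :
    x ⬝ᵥ ((Nᵀ * X * N) *ᵥ x) = (N *ᵥ x) ⬝ᵥ (X *ᵥ (N *ᵥ x)) := by
  rw [← Matrix.mulVec_mulVec, ← Matrix.mulVec_mulVec, Matrix.dotProduct_mulVec x,
    Matrix.vecMul_transpose]

lemma IsStableMatrix.isUnit_one_sub {n : ℕ} {M : Matrix (Fin n) (Fin n) ℝ}
    (hM : IsStableMatrix M) : IsUnit (1 - M) := by
  rw [Matrix.isUnit_iff_isUnit_det, isUnit_iff_ne_zero]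
  intro h0
  obtain ⟨v, hv, h⟩ := Matrix.exists_mulVec_eq_zero_iff.2 h0
  rw [Matrix.sub_mulVec, Matrix.one_mulVec, sub_eq_zero] at h
  have hv' : (fun i => (v i : ℂ)) ≠ 0 := fun h' => hv <| funext fun i => by
    simpa using congrFun h' i
  have := hM 1 (mem_spectrum_of_eigenvector hv' (by
    funext i
    have := congrArg (Complex.ofReal) (congrFun h i)
    simpa [Matrix.mulVec, dotProduct] using this.symm))
  norm_num at this

/-- Powers of the Cayley transform of a stable matrix tend to zero. -/
lemma IsStableMatrix.tendsto_cayley_pow {n : ℕ} {M : Matrix (Fin n) (Fin n) ℝ}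
    (hM : IsStableMatrix M) :
    Tendsto (fun k : ℕ => ((1 + M) * (1 - M)⁻¹) ^ k) atTop (𝓝 0) := by
  set C := (1 + M) * (1 - M)⁻¹ with hC
  have hinv : (1 - M) * (1 - M)⁻¹ = 1 :=
    Matrix.mul_nonsing_inv _ ((Matrix.isUnit_iff_isUnit_det _).1 hM.isUnit_one_sub)
  let φ : Matrix (Fin n) (Fin n) ℝ →+* Matrix (Fin n) (Fin n) ℂ := Complex.ofRealHom.mapMatrix
  have hφ : ∀ X, φ X = X.map Complex.ofReal := fun X => rfl
  have hspec : ∀ z ∈ spectrum ℂ (φ C), ‖z‖ < 1 := by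
    intro z hz
    obtain ⟨v, hv, hvz⟩ := exists_eigenvector_of_mem_spectrum hz
    set u := φ ((1 - M)⁻¹) *ᵥ v with hu
    have h1 : v = u - φ M *ᵥ u := by
      have := congrArg φ hinv
      rw [map_mul, map_sub, map_one] at this
      rw [← Matrix.one_mulVec v, ← this, ← Matrix.mulVec_mulVec, ← hu, Matrix.sub_mulVec,
        Matrix.one_mulVec]
    have h2 : u + φ M *ᵥ u = z • v := by
      rw [← hvz, hC, map_mul, ← Matrix.mulVec_mulVec, ← hu, map_add, map_one, Matrix.add_mulVec,
        Matrix.one_mulVec]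
    have hu0 : u ≠ 0 := by
      intro h0
      rw [h0] at h1
      exact hv (by simpa using h1)
    -- On `u`, `M` has eigenvalue (z - 1)/(z + 1), whose real part has the sign of |z|² - 1.
    have h3 : (z + 1) • (φ M *ᵥ u) = (z - 1) • u := by
      rw [h1, smul_sub] at h2
      rw [add_smul, sub_smul, one_smul, one_smul]
      linear_combination (exp := 1) h2
    have hz1 : z + 1 ≠ 0 := by
      intro h0
      rw [h0, zero_smul] at h3
      rcases smul_eq_zero.1 h3.symm with h | h
      · have h5 : (2 : ℂ) = 0 := by linear_combination h0 - h
        norm_num at h5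
      · exact hu0 h
    have h4 : φ M *ᵥ u = ((z - 1) / (z + 1)) • u := by
      rw [div_eq_inv_mul, mul_smul, ← h3, smul_smul, inv_mul_cancel₀ hz1, one_smul]
    have h5 := hM _ (mem_spectrum_of_eigenvector hu0 h4)
    have hns : 0 < Complex.normSq (z + 1) := Complex.normSq_pos.2 hz1
    rw [Complex.div_re, ← add_div, div_lt_iff₀ hns, zero_mul] at h5
    simp at h5
    have h6 : ‖z‖ ^ 2 < 1 := by
      rw [← Complex.normSq_eq_norm_sq, Complex.normSq_apply]
      nlinarith
    nlinarith [norm_nonneg z]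
  have ht := tendsto_pow_zero_of_spectrum_lt_one _ hspec
  refine tendsto_pi_nhds.2 fun i => tendsto_pi_nhds.2 fun j => ?_
  have := (Complex.continuous_re.tendsto _).comp (tendsto_pi_nhds.1 (tendsto_pi_nhds.1 ht i) j)
  simp only [← map_pow] at this
  simpa [Function.comp_def, hφ] using this

/-- Turns the continuous-time Lyapunov operator into a discrete-time one, so that powers of the
Cayley transform replace the matrix exponential. -/
lemma lyapunov_cayley {n : ℕ} {M : Matrix (Fin n) (Fin n) ℝ} (hM : IsStableMatrix M)
    (X : Matrix (Fin n) (Fin n) ℝ) :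
    X - ((1 + M) * (1 - M)⁻¹)ᵀ * X * ((1 + M) * (1 - M)⁻¹) =
      ((1 - M)⁻¹)ᵀ * ((2 : ℝ) • -lyapunov M X) * (1 - M)⁻¹ := by
  have hinv : (1 - M) * (1 - M)⁻¹ = 1 :=
    Matrix.mul_nonsing_inv _ ((Matrix.isUnit_iff_isUnit_det _).1 hM.isUnit_one_sub)
  have hinv' : ((1 - M)⁻¹)ᵀ * (1 - M)ᵀ = 1 := by
    rw [← Matrix.transpose_mul, hinv, Matrix.transpose_one]
  have h : (2 : ℝ) • -lyapunov M X = (1 - M)ᵀ * X * (1 - M) - (1 + M)ᵀ * X * (1 + M) := by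
    rw [two_smul, lyapunov, Matrix.transpose_sub, Matrix.transpose_add, Matrix.transpose_one]
    noncomm_ring
  rw [h, mul_sub, sub_mul]
  congr 1
  · calc X = (((1 - M)⁻¹)ᵀ * (1 - M)ᵀ) * X * ((1 - M) * (1 - M)⁻¹) := by
          rw [hinv, hinv', one_mul, mul_one]
      _ = _ := by simp only [mul_assoc]
  · rw [Matrix.transpose_mul]
    simp only [mul_assoc]

/-- Lyapunov: for stable `M`, if `Mᵀ X + X M ≤ 0` then `X ≥ 0`. -/
lemma IsStableMatrix.posSemidef_of_lyapunov {n : ℕ} {M X : Matrix (Fin n) (Fin n) ℝ}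
    (hM : IsStableMatrix M) (hX : X.IsSymm) (h : (-lyapunov M X).PosSemidef) : X.PosSemidef := by
  rw [posSemidef_iff_real]
  refine ⟨hX, fun x => ?_⟩
  set C := (1 + M) * (1 - M)⁻¹ with hC
  have hstep : ∀ y : Fin n → ℝ, (C *ᵥ y) ⬝ᵥ (X *ᵥ (C *ᵥ y)) ≤ y ⬝ᵥ (X *ᵥ y) := by
    intro y
    rw [← sub_nonneg, ← dotProduct_transpose_mul_mulVec, ← dotProduct_sub, ← Matrix.sub_mulVec,
      lyapunov_cayley hM, dotProduct_transpose_mul_mulVec]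
    exact (posSemidef_iff_real.1 (h.smul (by norm_num : (0 : ℝ) ≤ 2))).2 _
  have hk : ∀ k : ℕ, (C ^ k *ᵥ x) ⬝ᵥ (X *ᵥ (C ^ k *ᵥ x)) ≤ x ⬝ᵥ (X *ᵥ x) := by
    intro k
    induction k with
    | zero => simp
    | succ k ih =>
      rw [pow_succ', ← Matrix.mulVec_mulVec]
      exact (hstep _).trans ih
  have ht : Tendsto (fun k : ℕ => (C ^ k *ᵥ x) ⬝ᵥ (X *ᵥ (C ^ k *ᵥ x))) atTop (𝓝 0) := by
    have hcont : Continuous fun N : Matrix (Fin n) (Fin n) ℝ => (N *ᵥ x) ⬝ᵥ (X *ᵥ (N *ᵥ x)) := by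
      fun_prop
    have := (hcont.tendsto 0).comp hM.tendsto_cayley_pow
    simpa [Function.comp_def] using this
  exact le_of_tendsto' ht hk

/-- Lyapunov: for stable `M`, if `Mᵀ X + X M < 0` then `X > 0`. -/
lemma IsStableMatrix.posDef_of_lyapunov {n : ℕ} {M X : Matrix (Fin n) (Fin n) ℝ}
    (hM : IsStableMatrix M) (hX : X.IsSymm) (h : (-lyapunov M X).PosDef) : X.PosDef := by
  have hX0 := posSemidef_iff_real.1 (hM.posSemidef_of_lyapunov hX h.posSemidef)
  rw [posDef_iff_real]
  -- A single Cayley step strictly decreases the form of `X`, which is still nonnegative afterwards.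
  refine ⟨hX, fun y hy => (hX0.2 (((1 + M) * (1 - M)⁻¹) *ᵥ y)).trans_lt ?_⟩
  rw [← sub_pos, ← dotProduct_transpose_mul_mulVec, ← dotProduct_sub, ← Matrix.sub_mulVec,
      lyapunov_cayley hM, dotProduct_transpose_mul_mulVec]
  refine (posDef_iff_real.1 (h.smul (by norm_num : (0 : ℝ) < 2))).2 _ fun h0 => hy ?_
  have hinv : (1 - M) * (1 - M)⁻¹ = 1 :=
    Matrix.mul_nonsing_inv _ ((Matrix.isUnit_iff_isUnit_det _).1 hM.isUnit_one_sub)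
  rw [← Matrix.one_mulVec y, ← hinv, ← Matrix.mulVec_mulVec, h0, Matrix.mulVec_zero]

/-- Converse Lyapunov theorem. -/
lemma isStableMatrix_of_lyapunov {n : ℕ} {M X : Matrix (Fin n) (Fin n) ℝ}
    (hX : X.PosSemidef) (h : (-lyapunov M X).PosDef) : IsStableMatrix M := by
  intro z hz
  obtain ⟨v, hv, hvz⟩ := exists_eigenvector_of_mem_spectrum hz
  set a : Fin n → ℝ := fun i => (v i).re with ha
  set b : Fin n → ℝ := fun i => (v i).im with hb
  have hMa : M *ᵥ a = z.re • a - z.im • b := by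
    funext i
    have := congrArg Complex.re (congrFun hvz i)
    simpa [Matrix.mulVec, dotProduct, ha, hb] using this
  have hMb : M *ᵥ b = z.re • b + z.im • a := by
    funext i
    have := congrArg Complex.im (congrFun hvz i)
    simpa [Matrix.mulVec, dotProduct, ha, hb] using this
  obtain ⟨hXs, hXn⟩ := posSemidef_iff_real.1 hX
  obtain ⟨hLs, hLp⟩ := posDef_iff_real.1 h
  have hLn : ∀ y, 0 ≤ y ⬝ᵥ (-lyapunov M X *ᵥ y) := (posSemidef_iff_real.1 h.posSemidef).2
  have hsym : ∀ y w : Fin n → ℝ, y ⬝ᵥ (X *ᵥ w) = w ⬝ᵥ (X *ᵥ y) := by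
    intro y w
    rw [Matrix.dotProduct_mulVec, ← Matrix.mulVec_transpose, hXs.eq, dotProduct_comm]
  have hL : ∀ y, y ⬝ᵥ (-lyapunov M X *ᵥ y) = -2 * ((M *ᵥ y) ⬝ᵥ (X *ᵥ y)) := by
    intro y
    rw [Matrix.neg_mulVec, dotProduct_neg, lyapunov, Matrix.add_mulVec, dotProduct_add,
      ← Matrix.mulVec_mulVec, ← Matrix.mulVec_mulVec, hsym y (M *ᵥ y), Matrix.dotProduct_mulVec y,
      Matrix.vecMul_transpose]
    ring
  have hpos : 0 < a ⬝ᵥ (-lyapunov M X *ᵥ a) + b ⬝ᵥ (-lyapunov M X *ᵥ b) := by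
    by_cases ha0 : a = 0
    · have hb0 : b ≠ 0 := fun hb0 => hv <| funext fun i =>
        Complex.ext (congrFun ha0 i) (congrFun hb0 i)
      exact add_pos_of_nonneg_of_pos (hLn a) (hLp b hb0)
    · exact add_pos_of_pos_of_nonneg (hLp a ha0) (hLn b)
  -- In the sum over real and imaginary parts the `z.im` terms cancel by symmetry of `X`, leaving -2
  -- Re z (aᵀXa + bᵀXb) > 0.
  rw [hL, hL, hMa, hMb] at hpos
  simp only [sub_dotProduct, add_dotProduct, smul_dotProduct, smul_eq_mul] at hpos
  rw [hsym b a] at hpos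
  have h1 := hXn a
  have h2 := hXn b
  by_contra hcon
  push Not at hcon
  nlinarith [mul_nonneg hcon h1, mul_nonneg hcon h2]

/-- Symmetric solutions of the Lyapunov equation of a stable matrix exist. -/
lemma IsStableMatrix.exists_lyapunov_eq {n : ℕ} {M : Matrix (Fin n) (Fin n) ℝ}
    (hM : IsStableMatrix M) {W : Matrix (Fin n) (Fin n) ℝ} (hW : W.IsSymm) :
    ∃ X : Matrix (Fin n) (Fin n) ℝ, X.IsSymm ∧ lyapunov M X = W := by
  let V : Submodule ℝ (Matrix (Fin n) (Fin n) ℝ) :=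
    { carrier := {X | X.IsSymm}
      add_mem' := fun ha hb => ha.add hb
      zero_mem' := Matrix.isSymm_zero
      smul_mem' := fun c _ hx => hx.smul c }
  let T : V →ₗ[ℝ] V :=
    { toFun := fun X => ⟨lyapunov M X.1, X.2.lyapunov⟩
      map_add' := fun X Y => Subtype.ext (by simp [lyapunov]; noncomm_ring)
      map_smul' := fun c X => Subtype.ext (by simp [lyapunov]) }
  -- A symmetric `X` in the kernel has both `X` and `-X` positive semidefinite; finite dimension
  -- then gives surjectivity.
  have hinj : Function.Injective T := by
    rw [← LinearMap.ker_eq_bot, LinearMap.ker_eq_bot']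
    intro X hX
    have h0 : lyapunov M X.1 = 0 := congrArg Subtype.val hX
    have h1 : (X.1).PosSemidef := hM.posSemidef_of_lyapunov X.2 (by
      rw [h0, neg_zero]; exact Matrix.PosSemidef.zero)
    have h2 : (-X.1).PosSemidef := hM.posSemidef_of_lyapunov (Matrix.IsSymm.neg X.2) (by
      rw [show lyapunov M (-X.1) = -lyapunov M X.1 by simp [lyapunov]; abel, h0, neg_zero, neg_zero]
      exact Matrix.PosSemidef.zero)
    have h3 : (X.1).trace = 0 := by
      have := h1.trace_nonneg
      have := h2.trace_nonneg
      rw [Matrix.trace_neg] at this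
      linarith
    exact Subtype.ext (h1.trace_eq_zero_iff.1 h3)
  obtain ⟨X, hX⟩ := LinearMap.injective_iff_surjective.1 hinj ⟨W, hW⟩
  exact ⟨X.1, X.2, congrArg Subtype.val hX⟩

lemma isAntiStableMatrix_iff_neg {n : ℕ} {M : Matrix (Fin n) (Fin n) ℝ} :
    IsAntiStableMatrix M ↔ IsStableMatrix (-M) := by
  have h : (-M).map Complex.ofReal = -(M.map Complex.ofReal) := by
    ext i j; simp
  unfold IsAntiStableMatrix IsStableMatrix
  rw [h, ← spectrum.neg_eq]
  constructor
  · intro H z hz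
    have := H (-z) hz
    simpa using this
  · intro H z hz
    have := H (-z) (by simpa using hz)
    simpa using this

/-! ### Order and compactness for symmetric matrices. -/

lemma Matrix.PosSemidef.isSymm {n : ℕ} {M : Matrix (Fin n) (Fin n) ℝ} (h : M.PosSemidef) :
    M.IsSymm := (posSemidef_iff_real.1 h).1

lemma Matrix.PosSemidef.symm_conj {n : ℕ} {G Y : Matrix (Fin n) (Fin n) ℝ} (hG : G.PosSemidef)
    (hY : Y.IsSymm) : (Y * G * Y).PosSemidef := by
  have h := hG.conjTranspose_mul_mul_same Y
  rwa [Matrix.conjTranspose_eq_transpose_of_trivial, hY.eq] at h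

/-- A symmetric real matrix is dominated by large multiples of the identity. -/
lemma exists_forall_smul_one_sub_posDef {n : ℕ} {M : Matrix (Fin n) (Fin n) ℝ} (hM : M.IsSymm) :
    ∃ c : ℝ, 0 < c ∧ ∀ d, c ≤ d → (d • (1 : Matrix (Fin n) (Fin n) ℝ) - M).PosDef := by
  have hs : 0 ≤ ∑ i, ∑ j, |M i j| :=
    Finset.sum_nonneg fun i _ => Finset.sum_nonneg fun j _ => abs_nonneg _
  refine ⟨1 + ∑ i, ∑ j, |M i j|, by linarith, fun d hd => posDef_iff_real.2 ⟨?_, fun x hx => ?_⟩⟩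
  · exact (Matrix.isSymm_one.smul d).sub hM
  have hxx : 0 < x ⬝ᵥ x := by
    have h := (posDef_iff_real.1 (Matrix.PosDef.one (n := Fin n) (R := ℝ))).2 x hx
    rwa [Matrix.one_mulVec] at h
  have hsq : ∀ i, x i ^ 2 ≤ x ⬝ᵥ x := fun i => by
    have := Finset.single_le_sum (f := fun i => x i * x i) (fun i _ => mul_self_nonneg _)
      (Finset.mem_univ i)
    simpa [dotProduct, sq] using this
  have hle : x ⬝ᵥ (M *ᵥ x) ≤ (∑ i, ∑ j, |M i j|) * (x ⬝ᵥ x) := by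
    rw [Finset.sum_mul]
    refine Finset.sum_le_sum fun i _ => ?_
    rw [Finset.sum_mul, Matrix.mulVec, dotProduct, Finset.mul_sum]
    refine Finset.sum_le_sum fun j _ => ?_
    have h1 : |x i * x j| ≤ x ⬝ᵥ x := by
      rw [abs_le]
      constructor <;> nlinarith [hsq i, hsq j, sq_nonneg (x i + x j), sq_nonneg (x i - x j)]
    calc x i * (M i j * x j) = M i j * (x i * x j) := by ring
      _ ≤ |M i j * (x i * x j)| := le_abs_self _
      _ = |M i j| * |x i * x j| := abs_mul _ _
      _ ≤ _ := mul_le_mul_of_nonneg_left h1 (abs_nonneg _)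
  rw [Matrix.sub_mulVec, dotProduct_sub, Matrix.smul_mulVec, Matrix.one_mulVec, dotProduct_smul,
    smul_eq_mul]
  nlinarith

lemma isClosed_setOf_posSemidef {n : ℕ} :
    IsClosed {M : Matrix (Fin n) (Fin n) ℝ | M.PosSemidef} := by
  simp only [posSemidef_iff_real, Matrix.IsSymm, Set.ofPred_and, Set.ofPred_forall]
  refine IsClosed.inter (isClosed_eq (by fun_prop) (by fun_prop)) ?_
  exact isClosed_iInter fun x => isClosed_le (by fun_prop) (by fun_prop)

/-- Testing on eᵢ ± eⱼ bounds 2|Yᵢⱼ| by Yᵢᵢ + Yⱼⱼ. Supplies the boundedness in the compactness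
argument. -/
lemma Matrix.PosSemidef.abs_apply_le_trace {n : ℕ} {Y : Matrix (Fin n) (Fin n) ℝ}
    (hY : Y.PosSemidef) (i j : Fin n) : |Y i j| ≤ Y.trace := by
  obtain ⟨hs, hn⟩ := posSemidef_iff_real.1 hY
  have hdiag : ∀ k, Y k k ≤ Y.trace := fun k =>
    Finset.single_le_sum (f := fun k => Y k k) (fun k _ => hY.diag_nonneg) (Finset.mem_univ k)
  have h1 := hn (Pi.single i 1 + Pi.single j 1)
  have h2 := hn (Pi.single i 1 - Pi.single j 1)
  simp only [Matrix.mulVec_add, Matrix.mulVec_sub, add_dotProduct, sub_dotProduct, dotProduct_add,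
    dotProduct_sub, Matrix.mulVec_single_one, single_one_dotProduct, Matrix.col_apply] at h1 h2
  have h3 := hs.apply i j
  have := hdiag i
  have := hdiag j
  rw [abs_le]
  constructor <;> linarith

/-! ### The standard Riccati equation. -/

/-- The Riccati expression `Aᵀ Y + Y A - Y G Y + W`. -/
def riccati {n : ℕ} (A G W Y : Matrix (Fin n) (Fin n) ℝ) : Matrix (Fin n) (Fin n) ℝ :=
  lyapunov A Y - Y * G * Y + W

lemma lyapunov_sub_mul {n : ℕ} (A : Matrix (Fin n) (Fin n) ℝ) {G Y : Matrix (Fin n) (Fin n) ℝ}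
    (hG : G.IsSymm) (hY : Y.IsSymm) (X : Matrix (Fin n) (Fin n) ℝ) :
    lyapunov (A - G * Y) X = lyapunov A X - Y * G * X - X * G * Y := by
  simp only [lyapunov, Matrix.transpose_sub, Matrix.transpose_mul, hG.eq, hY.eq]
  noncomm_ring

/-- `Y` is its own Lyapunov certificate: the closed-loop expression is -(W - riccati + YGY), and `W`
makes it strict. -/
lemma isStableMatrix_of_riccati {n : ℕ} {A G W Y : Matrix (Fin n) (Fin n) ℝ} (hG : G.PosSemidef)
    (hW : W.PosDef) (hY : Y.PosSemidef) (h : (-riccati A G W Y).PosSemidef) :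
    IsStableMatrix (A - G * Y) := by
  refine isStableMatrix_of_lyapunov hY ?_
  have e : -lyapunov (A - G * Y) Y = W + (-riccati A G W Y + Y * G * Y) := by
    rw [lyapunov_sub_mul A hG.isSymm hY.isSymm, riccati]
    abel
  rw [e]
  exact hW.add_posSemidef (h.add (hG.symm_conj hY.isSymm))

/-- The Newton (Kleinman) step for the Riccati equation. -/
lemma exists_newton_step {n : ℕ} {A G W Y : Matrix (Fin n) (Fin n) ℝ} (hG : G.PosSemidef)
    (hW : W.PosDef) (hY : Y.IsSymm) (hst : IsStableMatrix (A - G * Y)) :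
    ∃ Y' : Matrix (Fin n) (Fin n) ℝ, Y'.PosSemidef ∧ (-riccati A G W Y').PosSemidef ∧
      lyapunov (A - G * Y) Y' = -(W + Y * G * Y) := by
  have hWY : (W + Y * G * Y).PosSemidef := hW.posSemidef.add (hG.symm_conj hY)
  obtain ⟨Y', hs, he⟩ := hst.exists_lyapunov_eq hWY.isSymm.neg
  refine ⟨Y', hst.posSemidef_of_lyapunov hs (by rwa [he, neg_neg]), ?_, he⟩
  -- Completing the square: the Newton residual is purely quadratic in the step.
  have e : -riccati A G W Y' = (Y - Y') * G * (Y - Y') := by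
    rw [lyapunov_sub_mul A hG.isSymm hY, sub_sub, sub_eq_iff_eq_add] at he
    rw [riccati, he]
    noncomm_ring
  rw [e]
  exact hG.symm_conj (hY.sub hs)

/-- Hautus-type controllability: no nonzero `Aᵀ`-invariant subspace lies in the kernel of `G`. -/
def IsControllablePair {n : ℕ} (A G : Matrix (Fin n) (Fin n) ℝ) : Prop :=
  ∀ U : Submodule ℝ (Fin n → ℝ), (∀ v ∈ U, Aᵀ *ᵥ v ∈ U) → (∀ v ∈ U, G *ᵥ v = 0) → U = ⊥

lemma Matrix.PosSemidef.mulVec_eq_zero_of_dotProduct {n : ℕ} {Z : Matrix (Fin n) (Fin n) ℝ}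
    (hZ : Z.PosSemidef) {v : Fin n → ℝ} (h : v ⬝ᵥ (Z *ᵥ v) = 0) : Z *ᵥ v = 0 :=
  (hZ.dotProduct_mulVec_zero_iff v).1 (by simpa using h)

/-- Bass: a controllable pair is stabilizable by symmetric feedback. -/
lemma IsControllablePair.exists_stabilizing {n : ℕ} {A G : Matrix (Fin n) (Fin n) ℝ}
    (hc : IsControllablePair A G) (hG : G.PosSemidef) :
    ∃ Y : Matrix (Fin n) (Fin n) ℝ, Y.IsSymm ∧ IsStableMatrix (A - G * Y) := by
  have hAs : (-(A + Aᵀ)).IsSymm := (Matrix.isSymm_add_transpose_self A).neg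
  obtain ⟨c, hc0, hcd⟩ := exists_forall_smul_one_sub_posDef hAs
  -- The shift makes cI + A + Aᵀ ≻ 0, so the identity certifies stability of `Nᵀ`.
  set N : Matrix (Fin n) (Fin n) ℝ := -(A + (c / 2) • 1) with hN
  have hNst : IsStableMatrix Nᵀ := by
    refine isStableMatrix_of_lyapunov Matrix.PosSemidef.one ?_
    have e : -lyapunov Nᵀ 1 = c • (1 : Matrix (Fin n) (Fin n) ℝ) - -(A + Aᵀ) := by
      simp only [lyapunov, hN, Matrix.transpose_neg, Matrix.transpose_add, Matrix.transpose_smul,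
        Matrix.transpose_transpose, Matrix.transpose_one, mul_one, one_mul]
      module
    rw [e]
    exact hcd c le_rfl
  -- The factor 2 makes AZ + ZAᵀ = 2G - cZ, so with Y = Z⁻¹ the two feedback terms YGY cancel and
  -- the closed loop gives exactly -cY.
  obtain ⟨Z, hZs, hZ⟩ := hNst.exists_lyapunov_eq ((hG.isSymm.smul (2 : ℝ)).neg)
  have hG2 : ((2 : ℝ) • G).PosSemidef := hG.smul (by norm_num)
  have hZ0 : Z.PosSemidef := hNst.posSemidef_of_lyapunov hZs (by rwa [hZ, neg_neg])
  rw [lyapunov, Matrix.transpose_transpose] at hZ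
  -- The kernel of `Z` is Aᵀ-invariant and killed by `G`, so controllability makes `Z` invertible.
  have hker : ∀ v, Z *ᵥ v = 0 → G *ᵥ v = 0 ∧ Z *ᵥ (Aᵀ *ᵥ v) = 0 := by
    intro v hv
    have h1 : Z *ᵥ (Nᵀ *ᵥ v) = -((2 : ℝ) • (G *ᵥ v)) := by
      have := congrArg (fun X => X *ᵥ v) hZ
      simpa only [Matrix.add_mulVec, ← Matrix.mulVec_mulVec, hv, Matrix.mulVec_zero, zero_add,
        Matrix.neg_mulVec, Matrix.smul_mulVec] using this
    have h2 : v ⬝ᵥ (Z *ᵥ (Nᵀ *ᵥ v)) = 0 := by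
      rw [Matrix.dotProduct_mulVec, ← Matrix.mulVec_transpose, hZs.eq, hv, zero_dotProduct]
    have h3 : G *ᵥ v = 0 := by
      apply hG.mulVec_eq_zero_of_dotProduct
      rw [h1, dotProduct_neg, dotProduct_smul, smul_eq_mul] at h2
      linarith
    refine ⟨h3, ?_⟩
    rw [h3, smul_zero, neg_zero, hN, Matrix.transpose_neg, Matrix.transpose_add,
      Matrix.transpose_smul, Matrix.transpose_one, Matrix.neg_mulVec, Matrix.add_mulVec,
      Matrix.smul_mulVec, Matrix.one_mulVec, Matrix.mulVec_neg, Matrix.mulVec_add,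
      Matrix.mulVec_smul, hv, smul_zero, add_zero, neg_eq_zero] at h1
    exact h1
  have hbot := hc (LinearMap.ker Z.mulVecLin) (fun v hv => (hker v hv).2) (fun v hv => (hker v hv).1)
  have hZd : Z.PosDef := by
    refine posDef_iff_real.2 ⟨hZs, fun v hv => ?_⟩
    refine lt_of_le_of_ne ((posSemidef_iff_real.1 hZ0).2 v) fun h0 => hv ?_
    have : v ∈ LinearMap.ker Z.mulVecLin := hZ0.mulVec_eq_zero_of_dotProduct h0.symm
    rwa [hbot, Submodule.mem_bot] at this
  have hdet : IsUnit Z.det := (Matrix.isUnit_iff_isUnit_det _).1 hZd.isUnit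
  have hYs : (Z⁻¹).IsSymm := by
    rw [Matrix.IsSymm, Matrix.transpose_nonsing_inv, hZs.eq]
  refine ⟨Z⁻¹, hYs, isStableMatrix_of_lyapunov hZd.inv.posSemidef ?_⟩
  have e1 : A * Z + Z * Aᵀ = (2 : ℝ) • G - c • Z := by
    have e : A * Z + Z * Aᵀ = -(N * Z + Z * Nᵀ) - c • Z := by
      simp only [hN, Matrix.transpose_neg, Matrix.transpose_add, Matrix.transpose_smul,
        Matrix.transpose_one, neg_mul, mul_neg, add_mul, mul_add, smul_mul_assoc, mul_smul_comm,
        one_mul, mul_one]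
      module
    rw [e, hZ, neg_neg]
  have e2 : lyapunov A Z⁻¹ = (2 : ℝ) • (Z⁻¹ * G * Z⁻¹) - c • Z⁻¹ := by
    have h := congrArg (fun X => Z⁻¹ * X * Z⁻¹) e1
    simp only [mul_add, add_mul, mul_sub, sub_mul, mul_smul_comm, smul_mul_assoc,
      Matrix.nonsing_inv_mul _ hdet, one_mul] at h
    rw [← mul_assoc, Matrix.mul_assoc (Z⁻¹ * A), Matrix.mul_nonsing_inv _ hdet, mul_one,
      ← mul_assoc, Matrix.nonsing_inv_mul _ hdet, one_mul] at h
    rw [lyapunov, add_comm, h]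
  rw [lyapunov_sub_mul A hG.isSymm hYs, e2]
  have e3 : -((2 : ℝ) • (Z⁻¹ * G * Z⁻¹) - c • Z⁻¹ - Z⁻¹ * G * Z⁻¹ - Z⁻¹ * G * Z⁻¹) = c • Z⁻¹ := by
    module
  rw [e3]
  exact hZd.inv.smul hc0

/-- The algebraic Riccati equation of a controllable pair has a stabilizing solution. -/
theorem IsControllablePair.exists_riccati_eq_zero {n : ℕ} {A G W : Matrix (Fin n) (Fin n) ℝ}
    (hc : IsControllablePair A G) (hG : G.PosSemidef) (hW : W.PosDef) :
    ∃ Y : Matrix (Fin n) (Fin n) ℝ, Y.IsSymm ∧ riccati A G W Y = 0 ∧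
      IsStableMatrix (A - G * Y) := by
  obtain ⟨Y₀, hY₀, hst₀⟩ := hc.exists_stabilizing hG
  obtain ⟨Y₁, hY₁, hr₁, -⟩ := exists_newton_step hG hW hY₀ hst₀
  -- The trace cap makes the set compact; the first Newton iterate `Y₁` makes it nonempty.
  set K : Set (Matrix (Fin n) (Fin n) ℝ) :=
    {Y | Y.PosSemidef ∧ (-riccati A G W Y).PosSemidef ∧ Y.trace ≤ Y₁.trace} with hK
  have hcont : Continuous fun Y => -riccati A G W Y := by
    unfold riccati lyapunov
    fun_prop
  have htr : Continuous fun Y : Matrix (Fin n) (Fin n) ℝ => Y.trace := by fun_prop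
  have hKc : IsCompact K := by
    have hbox : IsCompact (Set.pi Set.univ fun _ : Fin n => Set.pi Set.univ fun _ : Fin n =>
        Set.Icc (-Y₁.trace) Y₁.trace) :=
      isCompact_univ_pi fun _ => isCompact_univ_pi fun _ => isCompact_Icc
    refine IsCompact.of_isClosed_subset hbox ?_ fun Y hY i _ j _ => ?_
    · refine isClosed_setOf_posSemidef.inter (IsClosed.inter ?_ ?_)
      · exact isClosed_setOf_posSemidef.preimage hcont
      · exact isClosed_le htr continuous_const
    · exact abs_le.1 ((hY.1.abs_apply_le_trace i j).trans hY.2.2)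
  obtain ⟨Y, hYK, hmin⟩ := hKc.exists_isMinOn ⟨Y₁, hY₁, hr₁, le_rfl⟩ htr.continuousOn
  have hst := isStableMatrix_of_riccati hG hW hYK.1 hYK.2.1
  obtain ⟨Y', hY', hr', he⟩ := exists_newton_step hG hW hYK.1.isSymm hst
  -- The Newton step from the minimizer goes down, so Y' stays in `K`; minimality of the trace
  -- forces Y' = Y.
  have hdiff : (Y - Y').PosSemidef := by
    refine hst.posSemidef_of_lyapunov (hYK.1.isSymm.sub hY'.isSymm) ?_
    have e : -lyapunov (A - G * Y) (Y - Y') = -riccati A G W Y := by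
      have e1 : lyapunov (A - G * Y) (Y - Y') =
          lyapunov (A - G * Y) Y - lyapunov (A - G * Y) Y' := by
        simp only [lyapunov]; noncomm_ring
      rw [e1, he, lyapunov_sub_mul A hG.isSymm hYK.1.isSymm, riccati]
      abel
    rw [e]
    exact hYK.2.1
  have htr1 := hdiff.trace_nonneg
  rw [Matrix.trace_sub] at htr1
  have htr2 : Y.trace ≤ Y'.trace := hmin ⟨hY', hr', by linarith [hYK.2.2]⟩
  have heq : Y - Y' = 0 := hdiff.trace_eq_zero_iff.1 (by rw [Matrix.trace_sub]; linarith)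
  rw [← sub_eq_zero.1 heq, lyapunov_sub_mul A hG.isSymm hYK.1.isSymm] at he
  refine ⟨Y, hYK.1.isSymm, ?_, hst⟩
  rw [sub_eq_iff_eq_add, sub_eq_iff_eq_add] at he
  rw [riccati, he]
  abel

/-! ### From the Kalman rank condition to invariant subspaces. -/

lemma IsControllable.eq_zero_of_forall {n m : ℕ} {A : Matrix (Fin n) (Fin n) ℝ}
    {B : Matrix (Fin n) (Fin m) ℝ} (h : IsControllable A B) {v : Fin n → ℝ}
    (hv : ∀ k : ℕ, Bᵀ *ᵥ ((Aᵀ) ^ k *ᵥ v) = 0) : v = 0 := by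
  unfold IsControllable at h
  rw [← Matrix.rank_transpose] at h
  have hker : LinearMap.ker (controllabilityMatrix A B)ᵀ.mulVecLin = ⊥ := by
    have h1 := LinearMap.finrank_range_add_finrank_ker (controllabilityMatrix A B)ᵀ.mulVecLin
    rw [← Matrix.rank, h, Module.finrank_fintype_fun_eq_card, Fintype.card_fin] at h1
    exact Submodule.finrank_eq_zero.1 (by omega)
  have hmem : v ∈ LinearMap.ker (controllabilityMatrix A B)ᵀ.mulVecLin := by
    rw [LinearMap.mem_ker, Matrix.mulVecLin_apply]
    funext kj
    have := congrFun (hv kj.1) kj.2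
    rw [Matrix.mulVec_mulVec, ← Matrix.transpose_pow, ← Matrix.transpose_mul] at this
    exact this
  rwa [hker, Submodule.mem_bot] at hmem

/-- Controllability survives state feedback, and `B` may be replaced by `B R Bᵀ` with `R > 0`. -/
lemma IsControllable.isControllablePair_feedback {n m : ℕ} {A : Matrix (Fin n) (Fin n) ℝ}
    {B : Matrix (Fin n) (Fin m) ℝ} (h : IsControllable A B) {R : Matrix (Fin m) (Fin m) ℝ}
    (hR : R.PosDef) (K : Matrix (Fin m) (Fin n) ℝ) :
    IsControllablePair (A - B * K) (B * R * Bᵀ) := by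
  intro U hU hG
  have hB : ∀ v ∈ U, Bᵀ *ᵥ v = 0 := by
    intro v hv
    -- G v = 0 gives (Bᵀv)ᵀR(Bᵀv) = 0, hence Bᵀv = 0; the feedback term then vanishes on `U`.
    by_contra hne
    have h1 := (posDef_iff_real.1 hR).2 _ hne
    rw [← dotProduct_transpose_mul_mulVec, Matrix.transpose_transpose, hG v hv,
      dotProduct_zero] at h1
    exact lt_irrefl _ h1
  have hA : ∀ v ∈ U, Aᵀ *ᵥ v ∈ U := by
    intro v hv
    have h1 := hU v hv
    rwa [Matrix.transpose_sub, Matrix.transpose_mul, Matrix.sub_mulVec, ← Matrix.mulVec_mulVec,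
      hB v hv, Matrix.mulVec_zero, sub_zero] at h1
  have hpow : ∀ k : ℕ, ∀ v ∈ U, (Aᵀ) ^ k *ᵥ v ∈ U := by
    intro k
    induction k with
    | zero => intro v hv; simpa using hv
    | succ k ih =>
      intro v hv
      rw [pow_succ, ← Matrix.mulVec_mulVec]
      exact ih _ (hA v hv)
  rw [Submodule.eq_bot_iff]
  exact fun v hv => h.eq_zero_of_forall fun k => hB _ (hpow k v hv)

lemma IsControllablePair.neg {n : ℕ} {A G : Matrix (Fin n) (Fin n) ℝ}
    (h : IsControllablePair A G) : IsControllablePair (-A) G := by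
  intro U hU hG
  refine h U (fun v hv => ?_) hG
  have h1 := hU v hv
  rwa [Matrix.transpose_neg, Matrix.neg_mulVec, U.neg_mem_iff] at h1

/-! ### Expansion of F and existence of extremal solutions. -/

namespace KYPData

variable {n m p : ℕ} (D : KYPData n m p) (x : Fin p → ℝ)

/-- The weight `B (-R)⁻¹ Bᵀ` of the quadratic term of the Riccati map. -/
noncomputable def quadWeight : Matrix (Fin n) (Fin n) ℝ :=
  D.B * (-D.R x)⁻¹ * D.Bᵀ

/-- The closed-loop matrix `A - B K`. -/
noncomputable def closedLoop (P : Matrix (Fin n) (Fin n) ℝ) : Matrix (Fin n) (Fin n) ℝ :=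
  D.A - D.B * D.gain P x

variable {x}

lemma quadWeight_eq (hR : (-(D.R x)).PosDef) :
    D.quadWeight x = -(D.B * (D.R x)⁻¹ * D.Bᵀ) := by
  have hdet : IsUnit (D.R x).det := (Matrix.isUnit_iff_isUnit_det _).1 (by simpa using hR.isUnit.neg)
  have : (-D.R x)⁻¹ = -(D.R x)⁻¹ := Matrix.inv_eq_right_inv (by
    rw [neg_mul_neg, Matrix.mul_nonsing_inv _ hdet])
  rw [quadWeight, this, Matrix.mul_neg, Matrix.neg_mul]

lemma R_inv_transpose (hR : (-(D.R x)).PosDef) : ((D.R x)⁻¹)ᵀ = (D.R x)⁻¹ := by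
  have : (D.R x)ᵀ = D.R x := by
    simpa using hR.posSemidef.isSymm.eq
  rw [Matrix.transpose_nonsing_inv, this]

lemma quadWeight_posSemidef (hR : (-(D.R x)).PosDef) : (D.quadWeight x).PosSemidef := by
  have h := hR.inv.posSemidef.mul_mul_conjTranspose_same D.B
  rwa [Matrix.conjTranspose_eq_transpose_of_trivial] at h

/-- Exact second-order expansion of the Riccati map. -/
lemma F_add (hR : (-(D.R x)).PosDef) {P X : Matrix (Fin n) (Fin n) ℝ} (hX : X.IsSymm) :
    D.F (P + X) x =
      D.F P x + lyapunov (D.closedLoop x P) X + X * D.quadWeight x * X := by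
  rw [D.quadWeight_eq hR]
  simp only [F, lyapunov, closedLoop, gain, Matrix.transpose_add, Matrix.transpose_sub,
    Matrix.transpose_mul, Matrix.transpose_transpose, hX.eq, D.R_inv_transpose hR, Matrix.add_mul,
    Matrix.mul_add, Matrix.sub_mul, Matrix.mul_sub, Matrix.mul_neg, Matrix.neg_mul,
    Matrix.mul_assoc]
  abel

lemma closedLoop_add (hR : (-(D.R x)).PosDef) {P X : Matrix (Fin n) (Fin n) ℝ} (hX : X.IsSymm) :
    D.closedLoop x (P + X) = D.closedLoop x P + D.quadWeight x * X := by
  rw [D.quadWeight_eq hR]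
  simp only [closedLoop, gain, Matrix.transpose_add, Matrix.transpose_mul, hX.eq, Matrix.add_mul,
    Matrix.mul_add, Matrix.neg_mul, Matrix.mul_assoc]
  abel

lemma F_sub_eq_neg_riccati (hR : (-(D.R x)).PosDef) {P Y : Matrix (Fin n) (Fin n) ℝ}
    (hY : Y.IsSymm) :
    D.F (P - Y) x = -riccati (D.closedLoop x P) (D.quadWeight x) (-D.F P x) Y := by
  rw [sub_eq_add_neg, D.F_add hR hY.neg, riccati]
  simp only [lyapunov]
  noncomm_ring

/-- Moving upward from `P` reverses time, which reduces anti-stabilizing solutions to stabilizing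
ones. -/
lemma F_add_eq_neg_riccati (hR : (-(D.R x)).PosDef) {P Y : Matrix (Fin n) (Fin n) ℝ}
    (hY : Y.IsSymm) :
    D.F (P + Y) x = -riccati (-D.closedLoop x P) (D.quadWeight x) (-D.F P x) Y := by
  rw [D.F_add hR hY, riccati]
  simp only [lyapunov, Matrix.transpose_neg]
  noncomm_ring

lemma isControllablePair_closedLoop (hctrl : IsControllable D.A D.B) (hR : (-(D.R x)).PosDef)
    (P : Matrix (Fin n) (Fin n) ℝ) :
    IsControllablePair (D.closedLoop x P) (D.quadWeight x) :=
  hctrl.isControllablePair_feedback hR.inv _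

lemma exists_isStabilizingSolution (hctrl : IsControllable D.A D.B) (hR : (-(D.R x)).PosDef)
    {P : Matrix (Fin n) (Fin n) ℝ} (hP : P.IsSymm) (hF : (-(D.F P x)).PosDef) :
    ∃ Pminus, D.IsStabilizingSolution x Pminus := by
  obtain ⟨Y, hY, hr, hst⟩ := (D.isControllablePair_closedLoop hctrl hR P).exists_riccati_eq_zero
    (D.quadWeight_posSemidef hR) hF
  refine ⟨P - Y, hP.sub hY, by rw [D.F_sub_eq_neg_riccati hR hY, hr, neg_zero], ?_⟩
  have e : D.closedLoop x (P - Y) = D.closedLoop x P - D.quadWeight x * Y := by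
    rw [sub_eq_add_neg, D.closedLoop_add hR hY.neg, mul_neg, sub_eq_add_neg]
  rwa [← e] at hst

lemma exists_isAntiStabilizingSolution (hctrl : IsControllable D.A D.B)
    (hR : (-(D.R x)).PosDef) {P : Matrix (Fin n) (Fin n) ℝ} (hP : P.IsSymm)
    (hF : (-(D.F P x)).PosDef) : ∃ Pplus, D.IsAntiStabilizingSolution x Pplus := by
  obtain ⟨Y, hY, hr, hst⟩ :=
    (D.isControllablePair_closedLoop hctrl hR P).neg.exists_riccati_eq_zero
      (D.quadWeight_posSemidef hR) hF
  refine ⟨P + Y, hP.add hY, by rw [D.F_add_eq_neg_riccati hR hY, hr, neg_zero], ?_⟩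
  rw [isAntiStableMatrix_iff_neg]
  have e : -D.closedLoop x (P + Y) = -D.closedLoop x P - D.quadWeight x * Y := by
    rw [D.closedLoop_add hR hY, neg_add, sub_eq_add_neg]
  rwa [← e] at hst

/-! ### Comparison with the extremal solutions. -/

variable {D}

lemma IsStabilizingSolution.neg_lyapunov (hR : (-(D.R x)).PosDef)
    {Pminus P : Matrix (Fin n) (Fin n) ℝ} (h : D.IsStabilizingSolution x Pminus) (hP : P.IsSymm) :
    -lyapunov (D.closedLoop x Pminus) (P - Pminus) =
      -D.F P x + (P - Pminus) * D.quadWeight x * (P - Pminus) := by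
  have e := D.F_add hR (P := Pminus) (hP.sub h.1)
  rw [add_sub_cancel, h.2.1, zero_add] at e
  rw [e]
  abel

lemma IsAntiStabilizingSolution.neg_lyapunov (hR : (-(D.R x)).PosDef)
    {Pplus P : Matrix (Fin n) (Fin n) ℝ} (h : D.IsAntiStabilizingSolution x Pplus)
    (hP : P.IsSymm) :
    -lyapunov (-D.closedLoop x Pplus) (Pplus - P) =
      -D.F P x + (Pplus - P) * D.quadWeight x * (Pplus - P) := by
  have e := D.F_sub_eq_neg_riccati hR (P := Pplus) (h.1.sub hP)
  rw [sub_sub_cancel, h.2.1, riccati, neg_zero, add_zero] at e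
  rw [e]
  simp only [lyapunov, Matrix.transpose_neg]
  noncomm_ring

lemma IsStabilizingSolution.sub_posSemidef (hR : (-(D.R x)).PosDef)
    {Pminus P : Matrix (Fin n) (Fin n) ℝ} (h : D.IsStabilizingSolution x Pminus) (hP : P.IsSymm)
    (hF : (-(D.F P x)).PosSemidef) : (P - Pminus).PosSemidef := by
  refine IsStableMatrix.posSemidef_of_lyapunov (M := D.closedLoop x Pminus) h.2.2 (hP.sub h.1) ?_
  rw [h.neg_lyapunov hR hP]
  exact hF.add ((D.quadWeight_posSemidef hR).symm_conj (hP.sub h.1))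

lemma IsStabilizingSolution.sub_posDef (hR : (-(D.R x)).PosDef)
    {Pminus P : Matrix (Fin n) (Fin n) ℝ} (h : D.IsStabilizingSolution x Pminus) (hP : P.IsSymm)
    (hF : (-(D.F P x)).PosDef) : (P - Pminus).PosDef := by
  refine IsStableMatrix.posDef_of_lyapunov (M := D.closedLoop x Pminus) h.2.2 (hP.sub h.1) ?_
  rw [h.neg_lyapunov hR hP]
  exact hF.add_posSemidef ((D.quadWeight_posSemidef hR).symm_conj (hP.sub h.1))

lemma IsAntiStabilizingSolution.isStableMatrix_neg {Pplus : Matrix (Fin n) (Fin n) ℝ}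
    (h : D.IsAntiStabilizingSolution x Pplus) : IsStableMatrix (-D.closedLoop x Pplus) :=
  isAntiStableMatrix_iff_neg.1 h.2.2

lemma IsAntiStabilizingSolution.sub_posSemidef (hR : (-(D.R x)).PosDef)
    {Pplus P : Matrix (Fin n) (Fin n) ℝ} (h : D.IsAntiStabilizingSolution x Pplus) (hP : P.IsSymm)
    (hF : (-(D.F P x)).PosSemidef) : (Pplus - P).PosSemidef := by
  refine h.isStableMatrix_neg.posSemidef_of_lyapunov (h.1.sub hP) ?_
  rw [h.neg_lyapunov hR hP]
  exact hF.add ((D.quadWeight_posSemidef hR).symm_conj (h.1.sub hP))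

/-- Strict solutions of the Riccati inequality exist arbitrarily close below an anti-stabilizing
solution. -/
lemma IsAntiStabilizingSolution.exists_strict_near (hR : (-(D.R x)).PosDef)
    {Pplus : Matrix (Fin n) (Fin n) ℝ} (h : D.IsAntiStabilizingSolution x Pplus) {ε : ℝ}
    (hε : 0 < ε) : ∃ P : Matrix (Fin n) (Fin n) ℝ, P.IsSymm ∧ (-(D.F P x)).PosDef ∧
      (P - (Pplus - ε • (1 : Matrix (Fin n) (Fin n) ℝ))).PosDef ∧ (Pplus - P).PosDef := by
  obtain ⟨H, hH, he⟩ := h.isStableMatrix_neg.exists_lyapunov_eq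
    (Matrix.isSymm_one (n := Fin n) (α := ℝ)).neg
  have hHp : H.PosDef := h.isStableMatrix_neg.posDef_of_lyapunov hH (by
    rw [he, neg_neg]; exact Matrix.PosDef.one)
  have hHG := (D.quadWeight_posSemidef hR).symm_conj hH
  obtain ⟨c, hc, hcd⟩ := exists_forall_smul_one_sub_posDef hHG.isSymm
  obtain ⟨d, hd, hdd⟩ := exists_forall_smul_one_sub_posDef hH
  -- Since F(P₊ - tH) = -tI + t²HGH, the bound 1/c gives strictness; the bound ε/d gives tH ≺ εI.
  set t : ℝ := min (1 / c) (ε / d) with ht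
  have ht0 : 0 < t := lt_min (by positivity) (by positivity)
  have ht1 : c ≤ 1 / t := (le_one_div hc ht0).2 (min_le_left _ _)
  have ht2 : d ≤ ε / t := by
    rw [le_div_iff₀ ht0, mul_comm, ← le_div_iff₀ hd]
    exact min_le_right _ _
  refine ⟨Pplus - t • H, h.1.sub (hH.smul t), ?_, ?_, ?_⟩
  · have hl : lyapunov (D.closedLoop x Pplus) H = 1 := by
      have : lyapunov (-D.closedLoop x Pplus) H = -lyapunov (D.closedLoop x Pplus) H := by
        simp only [lyapunov, Matrix.transpose_neg]
        noncomm_ring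
      rwa [this, neg_inj] at he
    have hl' : lyapunov (D.closedLoop x Pplus) (t • H) = t • 1 := by
      rw [← hl, lyapunov, lyapunov, mul_smul_comm, smul_mul_assoc, smul_add]
    have e : -D.F (Pplus - t • H) x =
        (t ^ 2) • ((1 / t) • (1 : Matrix (Fin n) (Fin n) ℝ) - H * D.quadWeight x * H) := by
      rw [D.F_sub_eq_neg_riccati hR (hH.smul t), riccati, hl', h.2.1, smul_sub, smul_smul]
      have : t ^ 2 * (1 / t) = t := by field_simp
      rw [this]
      simp only [smul_mul_assoc, mul_smul_comm]
      module
    rw [e]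
    exact (hcd _ ht1).smul (by positivity)
  · have e : Pplus - t • H - (Pplus - ε • (1 : Matrix (Fin n) (Fin n) ℝ)) =
        t • ((ε / t) • (1 : Matrix (Fin n) (Fin n) ℝ) - H) := by
      rw [smul_sub, smul_smul, mul_div_cancel₀ _ ht0.ne']
      abel
    rw [e]
    exact (hdd _ ht2).smul ht0
  · rw [sub_sub_cancel]
    exact hHp.smul ht0

end KYPData

theorem mainTheorem4 {n m p : ℕ} (D : KYPData n m p)
    (hctrl : IsControllable D.A D.B)
    (x : Fin p → ℝ) (hR : (-(D.R x)).PosDef) :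
    ((∃ P : Matrix (Fin n) (Fin n) ℝ, P.IsSymm ∧ (-(D.F P x)).PosDef) ↔
      ((∃ Pplus, D.IsAntiStabilizingSolution x Pplus) ∧
        (∃ Pminus, D.IsStabilizingSolution x Pminus))) ∧
    (∀ Pplus Pminus : Matrix (Fin n) (Fin n) ℝ,
      D.IsAntiStabilizingSolution x Pplus → D.IsStabilizingSolution x Pminus →
        (∀ P : Matrix (Fin n) (Fin n) ℝ, P.IsSymm → (-(D.F P x)).PosSemidef →
          (P - Pminus).PosSemidef ∧ (Pplus - P).PosSemidef) ∧
        (∀ ε : ℝ, 0 < ε → ∃ P : Matrix (Fin n) (Fin n) ℝ,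
          P.IsSymm ∧ (-(D.F P x)).PosDef ∧
          (P - (Pplus - ε • (1 : Matrix (Fin n) (Fin n) ℝ))).PosDef ∧ (Pplus - P).PosDef) ∧
        (Pplus - Pminus).PosDef) := by
  refine ⟨⟨?_, ?_⟩, fun Pplus Pminus hp hm => ⟨fun P hP hF => ?_, fun ε hε => ?_, ?_⟩⟩
  · rintro ⟨P, hP, hF⟩
    exact ⟨D.exists_isAntiStabilizingSolution hctrl hR hP hF,
      D.exists_isStabilizingSolution hctrl hR hP hF⟩
  · rintro ⟨⟨Pplus, hp⟩, -⟩
    obtain ⟨P, hP, hF, -⟩ := hp.exists_strict_near hR one_pos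
    exact ⟨P, hP, hF⟩
  · exact ⟨hm.sub_posSemidef hR hP hF, hp.sub_posSemidef hR hP hF⟩
  · exact hp.exists_strict_near hR hε
  -- A strict solution `P` splits Δ as (P₊ - P) + (P - P₋), both positive definite.
  · obtain ⟨P, hP, hF, -, hlt⟩ := hp.exists_strict_near hR one_pos
    have h := hlt.add (hm.sub_posDef hR hP hF)
    rwa [sub_add_sub_cancel] at h
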